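/- Write $M_{a,b}$ for the complex $a\times b$ matrices, $M_a=M_{a,a}$, and identify $M_n(M_d)=M_n\otimes M_d=M_{nd}$. For a linear map $\varphi:V\to W$ put $\varphi^{(n)}((v_{ij}))=(\varphi(v_{ij}))$. Given sets $C_n\subseteq M_n(V)$, $D_n\subseteq M_n(W)$ ($n\ge 1$), $\varphi$ is completely positive if $\varphi^{(n)}(C_n)\subseteq D_n$ for all $n$. The space $M_d$ itself carries the cones of positive semidefinite matrices in $M_n(M_d)$. For $k\ge1$, $\mathrm{OMIN}_k(M_d)$ is $M_d$ with the cones $C^{k\text{-}min}_n$ of all $(a_{ij})\in M_n(M_d)$ such that $(\psi(a_{ij}))\ge 0$ for every unital linear map $\psi:M_d\to M_k$ with $\psi^{(k)}$ positive. $\mathrm{OMAX}_k(M_d)$ is $M_d$ with the cones $C^{k\text{-}max}_n$ of all $X\in M_n(M_d)$ such that $r I+X\in D^{k\text{-}max}_n$ for all real $r>0$, where $D^{k\text{-}max}_n$ is the set of all $A\,\mathrm{diag}(D_1,\dots,D_q)A^*$ with $q\in\mathbb N$, $A\in M_{n,qk}$ a scalar matrix and each $D_l\in M_k(M_d)$ positive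 semidefinite. A vector $U\in\mathbb C^n\otimes\mathbb C^d$ has Schmidt rank at most $k$ if $U=\sum_{e=1}^r\alpha_e\,u_e\otimes v_e$ for some $r\le k$, $\alpha_e\ge0$ and orthonormal families $(u_e)$ in $\mathbb C^n$, $(v_e)$ in $\mathbb C^d$. A state $s$ on $M_n\otimes M_d$ (a positive linear functional with $s(I)=1$) is $k$-separable if its density matrix $\rho_s=(s(E_{ij}\otimes E_{gh}))$, whose entry in row $(i,g)$ and column $(j,h)$ is $s(E_{ij}\otimes E_{gh})$, is a finite sum of matrices $UU^*$ with $U$ of Schmidt rank at most $k$. A positive linear functional $f$ on $M_n\otimes M_d$ is $k$-separable if $f=0$ or $f/f(I)$ is a $k$-separable state. A linear map $\varphi:M_p\to M_m$ is $k$-partially entanglement breaking if, for every $n\ge1$ and every state $s$ on $M_n\otimes M_m$, $s\circ\varphi^{(n)}$ is a $k$-separable positive linear functional on $M_n\otimes M_p$. **Theorem.** Let $\varphi:M_p\to M_m$ be a linear map and let $1\le k\le\min(p,m)$. The following are equivalent: (i) $\varphi:\mathrm{OMIN}_k(M_p)\to M_m$ is completely positive; (ii) $\varphi$ is $k$-partially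 entanglement breaking; (iii) $\varphi:M_p\to\mathrm{OMAX}_k(M_m)$ is completely positive; (iv) there are finitely many completely positive maps $\psi_l:M_p\to M_k$ and matrices $M_l\in M_{m,k}$, $1\le l\le q$, with $\varphi(X)=\sum_{l=1}^q M_l\psi_l(X)M_l^*$ for all $X\in M_p$; (v) there are finitely many matrices $A_l\in M_{p,m}$, $1\le l\le s$, each of rank at most $k$, with $\varphi(X)=\sum_{l=1}^s A_l^*XA_l$ for all $X\in M_p$; (vi) $\varphi:\mathrm{OMIN}_k(M_p)\to\mathrm{OMAX}_k(M_m)$ is completely positive. -/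

import Mathlib

open scoped ComplexOrder

/-- A family of matrix cones: for every `n`, a set of matrices in `M_n(V)`. -/
abbrev MatrixCones (V : Type*) := ∀ n : ℕ, Set (Matrix (Fin n) (Fin n) V)

/-- The matrix product `A v B` of a `V`-valued matrix with scalar matrices on both sides. -/
def scalarSandwich {V : Type*} [AddCommGroup V] [Module ℂ V] {a b c d : Type*}
    [Fintype b] [Fintype c] (A : Matrix a b ℂ) (v : Matrix b c V) (B : Matrix c d ℂ) :
    Matrix a d V :=
  Matrix.of fun i j => ∑ x, ∑ y, (A i x * B y j) • v x y

/-- A linear map is completely positive for given matrix cones when all its amplifications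
`(v_ij) ↦ (φ(v_ij))` map cones into cones. -/
def IsCompletelyPositive {V W : Type*} [AddCommGroup V] [Module ℂ V] [AddCommGroup W] [Module ℂ W]
    (C : MatrixCones V) (D : MatrixCones W) (φ : V →ₗ[ℂ] W) : Prop :=
  ∀ n : ℕ, ∀ A ∈ C n, A.map φ ∈ D n

/-- The standard matrix cones of `M_d`: a matrix over `M_d` is positive when the corresponding
block matrix, with scalar entries, is positive semidefinite. -/
def matCones (d : ℕ) : MatrixCones (Matrix (Fin d) (Fin d) ℂ) := fun n =>
  {A | (Matrix.comp (Fin n) (Fin n) (Fin d) (Fin d) ℂ A).PosSemidef}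

/-- `S_k(V)`: the unital `k`-positive linear maps from `V`, with cones `C` and unit `e`,
to `M_k`. -/
def unitalKPositiveMaps {V : Type*} [AddCommGroup V] [Module ℂ V] (k : ℕ) (C : MatrixCones V)
    (e : V) : Set (V →ₗ[ℂ] Matrix (Fin k) (Fin k) ℂ) :=
  {φ | φ e = 1 ∧ ∀ A ∈ C k, A.map φ ∈ matCones k k}

/-- The super `k`-minimal structure: `(a_ij)` is positive when `(φ(a_ij))` is positive for
every unital `k`-positive map `φ` into `M_k`. -/
def kMinCones {V : Type*} [AddCommGroup V] [Module ℂ V] (k : ℕ) (C : MatrixCones V) (e : V) :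
    MatrixCones V := fun n =>
  {A | ∀ φ ∈ unitalKPositiveMaps k C e, A.map φ ∈ matCones k n}

/-- The cones `D_n^{k-max}`: all `A diag(D_1, …, D_q) A*` with `A` a scalar `n × qk` matrix
and each `D_l` positive in `M_k(V)`. -/
def kMaxPreCones {V : Type*} [AddCommGroup V] [Module ℂ V] (k : ℕ) (C : MatrixCones V) :
    MatrixCones V := fun n =>
  {X | ∃ (q : ℕ) (A : Matrix (Fin n) (Fin k × Fin q) ℂ) (D : Fin q → Matrix (Fin k) (Fin k) V),
    (∀ l, D l ∈ C k) ∧ X = scalarSandwich A (Matrix.blockDiagonal D) A.conjTranspose}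

/-- The super `k`-maximal structure: the Archimedeanization of `D_n^{k-max}`. -/
def kMaxCones {V : Type*} [AddCommGroup V] [Module ℂ V] (k : ℕ) (C : MatrixCones V) (e : V) :
    MatrixCones V := fun n =>
  {A | ∀ r : ℝ, 0 < r → (r : ℂ) • Matrix.diagonal (fun _ => e) + A ∈ kMaxPreCones k C n}

/-- The matrix cones of `OMIN_k(M_d)`. -/
def OMIN (k d : ℕ) : MatrixCones (Matrix (Fin d) (Fin d) ℂ) := kMinCones k (matCones d) 1

/-- The matrix cones of `OMAX_k(M_d)`. -/
def OMAX (k d : ℕ) : MatrixCones (Matrix (Fin d) (Fin d) ℂ) := kMaxCones k (matCones d) 1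

/-- Linear functionals on `M_n ⊗ M_d`, identified with `M_n(M_d)`. -/
abbrev BipartiteFunctional (n d : ℕ) :=
  Matrix (Fin n) (Fin n) (Matrix (Fin d) (Fin d) ℂ) →ₗ[ℂ] ℂ

/-- Positive linear functionals on `M_n ⊗ M_d`. -/
def IsPositiveFunctional {n d : ℕ} (f : BipartiteFunctional n d) : Prop :=
  ∀ A ∈ matCones d n, 0 ≤ f A

/-- States on `M_n ⊗ M_d`. -/
def IsState {n d : ℕ} (f : BipartiteFunctional n d) : Prop :=
  IsPositiveFunctional f ∧ f 1 = 1

/-- The density (Choi) matrix `(f(E_ij ⊗ E_kl))` of a functional on `M_n ⊗ M_d`; its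
entry in row `(i, k)` and column `(j, l)` is `f(E_ij ⊗ E_kl)`. -/
def densityMatrix {n d : ℕ} (f : BipartiteFunctional n d) :
    Matrix (Fin n × Fin d) (Fin n × Fin d) ℂ :=
  Matrix.of fun a b => f (Matrix.single a.1 b.1 (Matrix.single a.2 b.2 1))

/-- A vector of `ℂ^n ⊗ ℂ^d` has Schmidt rank at most `k`: it has a Schmidt decomposition
`∑ α_e u_e ⊗ v_e`, with `u` and `v` orthonormal and `α_e ≥ 0`, of at most `k` terms. -/
def SchmidtRankLE {n d : ℕ} (k : ℕ) (U : Fin n × Fin d → ℂ) : Prop :=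
  ∃ r ≤ k, ∃ (α : Fin r → ℝ) (u : Fin r → EuclideanSpace ℂ (Fin n))
    (v : Fin r → EuclideanSpace ℂ (Fin d)),
    (∀ e, 0 ≤ α e) ∧ Orthonormal ℂ u ∧ Orthonormal ℂ v ∧
      ∀ i j, U (i, j) = ∑ e, (α e : ℂ) * (u e i * v e j)

/-- `ρ` has Schmidt number at most `k`: it is a finite sum of matrices `U U*` with `U` of
Schmidt rank at most `k`. -/
def SchmidtNumberLE {n d : ℕ} (k : ℕ) (ρ : Matrix (Fin n × Fin d) (Fin n × Fin d) ℂ) : Prop :=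
  ∃ (q : ℕ) (U : Fin q → Fin n × Fin d → ℂ),
    (∀ l, SchmidtRankLE k (U l)) ∧ ρ = ∑ l, Matrix.vecMulVec (U l) (star (U l))

/-- `k`-separable states. -/
def IsKSeparableState {n d : ℕ} (k : ℕ) (f : BipartiteFunctional n d) : Prop :=
  IsState f ∧ SchmidtNumberLE k (densityMatrix f)

/-- `k`-separable positive functionals: zero, or a `k`-separable state after normalization. -/
def IsKSeparable {n d : ℕ} (k : ℕ) (f : BipartiteFunctional n d) : Prop :=
  IsPositiveFunctional f ∧ (f = 0 ∨ IsKSeparableState k ((f 1)⁻¹ • f))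

/-- `φ` is `k`-partially entanglement breaking: `s ∘ φ^(n)` is `k`-separable for every `n` and
every state `s` on `M_n ⊗ M_m`. -/
def IsKPartiallyEntanglementBreaking {p m : ℕ} (k : ℕ)
    (φ : Matrix (Fin p) (Fin p) ℂ →ₗ[ℂ] Matrix (Fin m) (Fin m) ℂ) : Prop :=
  ∀ (n : ℕ) (s : BipartiteFunctional n m), IsState s → IsKSeparable k (s ∘ₗ φ.mapMatrix)

/-! Everything is read off the Choi matrix $C_\varphi=(\varphi(E_{ij}))$: each of the six conditions
holds exactly when $C_\varphi$ lies in `schmidtCone`, the cone generated by the $UU^*$ with $U$ of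
Schmidt rank at most $k$. Vectors of $\mathbb C^a\otimes\mathbb C^b$ are treated as $a\times b$
matrices, so Schmidt rank is matrix rank and $(A\otimes B)$ sends $W$ to $AWB^T$. Conjugating a
positive matrix by $A\otimes B$ therefore lands in the cone whenever $A$ or $B$ passes through
$\mathbb C^k$.

The two operator system structures are dual to one another. `mem_OMAX_iff` identifies the cones of
$\mathrm{OMAX}_k$ with Schmidt cones, and `mem_OMIN_iff` identifies those of $\mathrm{OMIN}_k$ with
the matrices nonnegative on vectors of Schmidt rank at most $k$.

A Kraus decomposition with operators of rank at most $k$ is the same as membership of $C_\varphi$ in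
the cone (`exists_kraus_iff`); factoring the operators through $\mathbb C^k$ gives (iv) and (vi).
Conversely, (ii) and (iii) are tested on the maximally entangled state or matrix, which returns
$C_\varphi$ itself. The delicate implication is from (i): if $C_\varphi$ were outside the cone,
Hahn–Banach would give a separating Hermitian matrix, which is an element of $\mathrm{OMIN}_k$
violating complete positivity. This needs the cone to be closed (`isClosed_schmidtCone`), as does
removing the Archimedeanization in $\mathrm{OMAX}_k$. -/

open Matrix
open scoped Kronecker

/-- The vector of `ℂ^a ⊗ ℂ^b` whose coefficients are the entries of a matrix. -/
def rowVec {a b : Type*} (M : Matrix a b ℂ) : a × b → ℂ := fun x => M x.1 x.2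

/-- The rank-one positive matrix attached to the vector of entries of `M`. -/
def rankOne {a b : Type*} (M : Matrix a b ℂ) : Matrix (a × b) (a × b) ℂ :=
  vecMulVec (rowVec M) (star (rowVec M))

/-- The cone of matrices of Schmidt number at most `k`. -/
def schmidtCone (a b : Type*) [Fintype b] (k : ℕ) : AddSubmonoid (Matrix (a × b) (a × b) ℂ) :=
  AddSubmonoid.closure {ρ | ∃ M : Matrix a b ℂ, M.rank ≤ k ∧ ρ = rankOne M}

set_option linter.unusedSectionVars false

/-- The Kronecker product. -/
def kron {a b c d : Type*} (A : Matrix a c ℂ) (B : Matrix b d ℂ) : Matrix (a × b) (c × d) ℂ :=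
  A ⊗ₖ B

/-! ### Schmidt cones and conjugation by Kronecker products -/

section Basic

variable {a b c d : Type*} [Fintype a] [Fintype b] [Fintype c] [Fintype d]

lemma rankOne_apply (M : Matrix a b ℂ) (x y : a × b) :
    rankOne M x y = M x.1 x.2 * star (M y.1 y.2) := rfl

lemma rankOne_zero : rankOne (0 : Matrix a b ℂ) = 0 := by
  ext x y; simp [rankOne_apply]

lemma rankOne_posSemidef (M : Matrix a b ℂ) : (rankOne M).PosSemidef :=
  posSemidef_vecMulVec_self_star _

lemma exists_rowVec_eq (v : a × b → ℂ) : ∃ M : Matrix a b ℂ, rowVec M = v :=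
  ⟨Matrix.of fun i j => v (i, j), rfl⟩

lemma rankOne_mem_schmidtCone {k : ℕ} {M : Matrix a b ℂ} (h : M.rank ≤ k) :
    rankOne M ∈ schmidtCone a b k :=
  AddSubmonoid.subset_closure ⟨M, h, rfl⟩

lemma mem_schmidtCone_iff {k : ℕ} {ρ : Matrix (a × b) (a × b) ℂ} :
    ρ ∈ schmidtCone a b k ↔
      ∃ (q : ℕ) (M : Fin q → Matrix a b ℂ), (∀ l, (M l).rank ≤ k) ∧ ρ = ∑ l, rankOne (M l) := by
  constructor
  · intro h
    induction h using AddSubmonoid.closure_induction with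
    | mem x hx =>
      obtain ⟨M, hM, rfl⟩ := hx
      exact ⟨1, fun _ => M, fun _ => hM, by simp⟩
    | zero => exact ⟨0, fun _ => 0, fun l => l.elim0, by simp⟩
    | add x y _ _ hx hy =>
      obtain ⟨q, M, hM, rfl⟩ := hx
      obtain ⟨r, N, hN, rfl⟩ := hy
      refine ⟨q + r, Fin.append M N, fun l => ?_, ?_⟩
      · refine Fin.addCases (fun i => ?_) (fun i => ?_) l
        · simpa using hM i
        · simpa using hN i
      · simp [Fin.sum_univ_add]
  · rintro ⟨q, M, hM, rfl⟩
    exact sum_mem fun l _ => rankOne_mem_schmidtCone (hM l)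

lemma posSemidef_of_mem_schmidtCone {k : ℕ} {ρ : Matrix (a × b) (a × b) ℂ}
    (h : ρ ∈ schmidtCone a b k) : ρ.PosSemidef := by
  obtain ⟨q, M, -, rfl⟩ := mem_schmidtCone_iff.1 h
  exact posSemidef_sum _ fun l _ => rankOne_posSemidef _

lemma exists_eq_sum_rankOne {ρ : Matrix (a × b) (a × b) ℂ} (h : ρ.PosSemidef) :
    ∃ (q : ℕ) (M : Fin q → Matrix a b ℂ), ρ = ∑ l, rankOne (M l) := by
  obtain ⟨q, v, rfl⟩ := posSemidef_iff_eq_sum_vecMulVec.1 h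
  exact ⟨q, fun l => Matrix.of fun i j => v l (i, j), rfl⟩

lemma rank_smul_le (r : ℂ) (M : Matrix a b ℂ) : (r • M).rank ≤ M.rank := by
  classical
  rw [smul_eq_diagonal_mul]
  exact rank_mul_le_right _ _

lemma rankOne_smul (r : ℝ) (M : Matrix a b ℂ) :
    rankOne ((r : ℂ) • M) = ((r ^ 2 : ℝ) : ℂ) • rankOne M := by
  ext x y
  simp [rankOne_apply]
  ring

lemma smul_mem_schmidtCone {k : ℕ} {ρ : Matrix (a × b) (a × b) ℂ}
    (h : ρ ∈ schmidtCone a b k) {r : ℝ} (hr : 0 ≤ r) : (r : ℂ) • ρ ∈ schmidtCone a b k := by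
  obtain ⟨q, M, hM, rfl⟩ := mem_schmidtCone_iff.1 h
  refine mem_schmidtCone_iff.2 ⟨q, fun l => (Real.sqrt r : ℂ) • M l,
    fun l => (rank_smul_le _ _).trans (hM l), ?_⟩
  simp only [rankOne_smul, Real.sq_sqrt hr, Finset.smul_sum]

lemma rank_map_star (M : Matrix a b ℂ) : (M.map star).rank = M.rank := by
  rw [← rank_conjTranspose M, ← rank_transpose Mᴴ]
  rfl

lemma kron_apply (A : Matrix a c ℂ) (B : Matrix b d ℂ) (x : a × b) (y : c × d) :
    kron A B x y = A x.1 y.1 * B x.2 y.2 := rfl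

lemma kron_mulVec_rowVec (A : Matrix a c ℂ) (B : Matrix b d ℂ) (W : Matrix c d ℂ) :
    kron A B *ᵥ rowVec W = rowVec (A * W * Bᵀ) := by
  ext ⟨i, j⟩
  simp only [mulVec, dotProduct, rowVec, kron_apply, mul_apply, transpose_apply,
    Fintype.sum_prod_type, Finset.sum_mul]
  rw [Finset.sum_comm]
  exact Finset.sum_congr rfl fun _ _ => Finset.sum_congr rfl fun _ _ => by ring

lemma mul_vecMulVec_mul_conjTranspose (K : Matrix a b ℂ) (u : b → ℂ) :
    K * vecMulVec u (star u) * Kᴴ = vecMulVec (K *ᵥ u) (star (K *ᵥ u)) := by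
  rw [mul_vecMulVec, vecMulVec_mul, star_mulVec]

lemma kron_mul_rankOne (A : Matrix a c ℂ) (B : Matrix b d ℂ) (W : Matrix c d ℂ) :
    kron A B * rankOne W * (kron A B)ᴴ = rankOne (A * W * Bᵀ) := by
  rw [rankOne, mul_vecMulVec_mul_conjTranspose, kron_mulVec_rowVec, rankOne]

/-- Each rank-one summand of `ρ`, with coefficient matrix `W`, becomes the one of `A * W * Bᵀ`. The
hypothesis holds as soon as one of the factors has rank at most `k`, or `W` has a side of length at
most `k`. -/
lemma kron_mul_mem_schmidtCone (A : Matrix a c ℂ) (B : Matrix b d ℂ) {k : ℕ}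
    (h : ∀ W : Matrix c d ℂ, (A * W * Bᵀ).rank ≤ k)
    {ρ : Matrix (c × d) (c × d) ℂ} (hρ : ρ.PosSemidef) :
    kron A B * ρ * (kron A B)ᴴ ∈ schmidtCone a b k := by
  obtain ⟨q, M, rfl⟩ := exists_eq_sum_rankOne hρ
  rw [Matrix.mul_sum, Matrix.sum_mul]
  refine sum_mem fun l _ => ?_
  rw [kron_mul_rankOne]
  exact rankOne_mem_schmidtCone (h _)

/-- Over $\mathbb C$ a real-valued quadratic form already forces the matrix to be Hermitian, by
polarization. -/
lemma posSemidef_of_forall_nonneg {M : Matrix a a ℂ}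
    (h : ∀ x : a → ℂ, 0 ≤ star x ⬝ᵥ (M *ᵥ x)) : M.PosSemidef := by
  classical
  refine PosSemidef.of_dotProduct_mulVec_nonneg ?_ h
  rw [← isSymmetric_toEuclideanLin_iff, LinearMap.isSymmetric_iff_inner_map_self_real]
  intro v
  have := (h v.ofLp)
  have h2 : inner ℂ v (toEuclideanLin M v) = star v.ofLp ⬝ᵥ (M *ᵥ v.ofLp) := by
    rw [EuclideanSpace.inner_eq_star_dotProduct, dotProduct_comm]
    rfl
  rw [inner_conj_symm, h2, ← inner_conj_symm, h2]
  exact (IsSelfAdjoint.of_nonneg this).symm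

end Basic

/-! ### Schmidt rank equals matrix rank -/

section Schmidt

/-- Singular value decomposition: a matrix of rank at most `k` has a Schmidt decomposition. -/
lemma schmidtRankLE_of_rank_le {n d k : ℕ} (M : Matrix (Fin n) (Fin d) ℂ) (h : M.rank ≤ k) :
    SchmidtRankLE k (rowVec M) := by
  classical
  have hP : (Mᴴ * M).PosSemidef := posSemidef_conjTranspose_mul_self M
  have hH := hP.isHermitian
  set lam := hH.eigenvalues with hlam
  have hcard : Fintype.card {i // lam i ≠ 0} ≤ k := by
    rw [hlam, ← hH.rank_eq_card_non_zero_eigs, rank_conjTranspose_mul_self]; exact h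
  set w := hH.eigenvectorBasis with hw
  have hnn : ∀ i, 0 ≤ lam i := fun i => hP.eigenvalues_nonneg i
  -- The images under `M` of the eigenvectors of `Mᴴ * M` are orthogonal, with the eigenvalues as
  -- squared norms.
  have hinner : ∀ i j, star (M *ᵥ (w i).ofLp) ⬝ᵥ (M *ᵥ (w j).ofLp) =
      if i = j then (lam j : ℂ) else 0 := by
    intro i j
    rw [star_mulVec, ← dotProduct_mulVec, mulVec_mulVec, hH.mulVec_eigenvectorBasis,
      dotProduct_smul]
    have := orthonormal_iff_ite.1 w.orthonormal i j
    rw [EuclideanSpace.inner_eq_star_dotProduct, dotProduct_comm] at this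
    rw [this]
    split_ifs <;> simp [hlam]
  let e := Fintype.equivFin {i // lam i ≠ 0}
  let f : Fin (Fintype.card {i // lam i ≠ 0}) → Fin d := fun l => (e.symm l).1
  have hf : ∀ l, lam (f l) ≠ 0 := fun l => (e.symm l).2
  have hfi : Function.Injective f := Subtype.val_injective.comp e.symm.injective
  have hsq : ∀ l, (Real.sqrt (lam (f l)) : ℂ) ≠ 0 := fun l => by
    simpa using (Real.sqrt_ne_zero (hnn _)).2 (hf l)
  have hsq2 : ∀ l, (Real.sqrt (lam (f l)) : ℂ) * (Real.sqrt (lam (f l)) : ℂ) = lam (f l) :=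
    fun l => by exact_mod_cast Real.mul_self_sqrt (hnn (f l))
  -- The right vectors are conjugated because $M=\sum\sigma_l\,u_lw_l^*$, whereas a Schmidt
  -- decomposition carries no conjugate.
  refine ⟨_, hcard, fun l => Real.sqrt (lam (f l)),
    fun l => WithLp.toLp 2 ((Real.sqrt (lam (f l)) : ℂ)⁻¹ • (M *ᵥ (w (f l)).ofLp)),
    fun l => WithLp.toLp 2 (star (w (f l)).ofLp), fun _ => Real.sqrt_nonneg _, ?_, ?_, ?_⟩
  · rw [orthonormal_iff_ite]
    intro i j
    rw [EuclideanSpace.inner_eq_star_dotProduct, dotProduct_comm]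
    simp only [star_smul, smul_dotProduct, dotProduct_smul, hinner, hfi.eq_iff]
    split_ifs with hij
    · subst hij
      simp only [smul_eq_mul, ← hsq2]
      have := hsq i
      simp
      field_simp
    · simp
  · rw [orthonormal_iff_ite]
    intro i j
    have := orthonormal_iff_ite.1 w.orthonormal (f j) (f i)
    rw [EuclideanSpace.inner_eq_star_dotProduct] at this ⊢
    simp only [star_star, hfi.eq_iff] at this ⊢
    rw [dotProduct_comm, this]
    simp only [eq_comm]
  · intro i j
    have key : ∀ s : Fin d, lam s = 0 → M *ᵥ (w s).ofLp = 0 := fun s hs => by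
      have := hinner s s
      rw [if_pos rfl, hs] at this
      simpa [dotProduct_star_self_eq_zero] using this
    have h1 : M i j = ∑ s, (M *ᵥ (w s).ofLp) i * star ((w s).ofLp j) := by
      have := w.sum_repr (EuclideanSpace.single j 1)
      have h3 : M i j = (M *ᵥ (EuclideanSpace.single j (1 : ℂ)).ofLp) i := by simp
      rw [h3, ← this]
      simp [mulVec_sum, Finset.sum_apply, w.repr_apply_apply, EuclideanSpace.inner_single_right,
        mulVec_smul, mul_comm]
    rw [rowVec, h1]
    refine (Finset.sum_of_injOn f hfi.injOn (by simp) ?_ ?_).symm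
    · intro s _ hs
      have : lam s = 0 := by
        by_contra hne
        exact hs ⟨e ⟨s, hne⟩, by simp, by simp [f]⟩
      simp [key s this]
    · intro l _
      have := hsq l
      simp only [Pi.smul_apply, Pi.star_apply, smul_eq_mul]
      field_simp

lemma rank_le_of_schmidtRankLE {n d k : ℕ} {M : Matrix (Fin n) (Fin d) ℂ}
    (h : SchmidtRankLE k (rowVec M)) : M.rank ≤ k := by
  obtain ⟨r, hr, α, u, v, -, -, -, hM⟩ := h
  have : M = (Matrix.of fun i e => (α e : ℂ) * u e i) * (Matrix.of fun (e : Fin r) j => v e j) := by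
    ext i j
    simpa [mul_apply, mul_assoc, rowVec] using hM i j
  rw [this]
  exact (rank_mul_le_left _ _).trans ((rank_le_width _).trans hr)

lemma schmidtNumberLE_iff {n d k : ℕ} {ρ : Matrix (Fin n × Fin d) (Fin n × Fin d) ℂ} :
    SchmidtNumberLE k ρ ↔ ρ ∈ schmidtCone (Fin n) (Fin d) k := by
  rw [mem_schmidtCone_iff]
  constructor
  · rintro ⟨q, U, hU, rfl⟩
    exact ⟨q, fun l => Matrix.of fun i j => U l (i, j),
      fun l => rank_le_of_schmidtRankLE (hU l), rfl⟩
  · rintro ⟨q, M, hM, rfl⟩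
    exact ⟨q, fun l => rowVec (M l), fun l => schmidtRankLE_of_rank_le _ (hM l), rfl⟩

/-- A matrix of rank at most `k ≤ d` factors through `ℂ^k`, with an isometry on the right. -/
lemma exists_isometry_factorization {n d k : ℕ} (hkd : k ≤ d) (M : Matrix (Fin n) (Fin d) ℂ)
    (h : M.rank ≤ k) :
    ∃ (W : Matrix (Fin n) (Fin k) ℂ) (B : Matrix (Fin d) (Fin k) ℂ),
      Bᴴ * B = 1 ∧ M = W * Bᵀ := by
  classical
  obtain ⟨r, hr, α, u, v, -, -, hv, hM⟩ := schmidtRankLE_of_rank_le M h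
  -- There may be only `r < k` Schmidt vectors: they are completed to an orthonormal basis of
  -- $\mathbb C^d$, so that `B` has `k` orthonormal columns, and the extra columns of `W` are zero.
  let v' : Fin d → EuclideanSpace ℂ (Fin d) := fun i => if hi : i.1 < r then v ⟨i.1, hi⟩ else 0
  have hv' : Orthonormal ℂ (({i | i.1 < r} : Set (Fin d)).domRestrict v') := by
    have : ({i | i.1 < r} : Set (Fin d)).domRestrict v' =
        v ∘ fun i : ({i | i.1 < r} : Set (Fin d)) => (⟨i.1.1, i.2⟩ : Fin r) := by
      ext i : 1
      have hi : i.1.1 < r := i.2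
      simp [v', Set.domRestrict, hi]
    rw [this]
    refine hv.comp _ fun i j hij => ?_
    simpa [Fin.ext_iff, Subtype.ext_iff] using hij
  obtain ⟨b, hb⟩ := hv'.exists_orthonormalBasis_extension_of_card_eq (by simp)
  refine ⟨Matrix.of fun i c => if hc : c.1 < r then (α ⟨c.1, hc⟩ : ℂ) * u ⟨c.1, hc⟩ i else 0,
    Matrix.of fun j c => b (Fin.castLE hkd c) j, ?_, ?_⟩
  · ext x y
    have := orthonormal_iff_ite.1 b.orthonormal (Fin.castLE hkd x) (Fin.castLE hkd y)
    rw [EuclideanSpace.inner_eq_star_dotProduct, dotProduct_comm] at this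
    simpa [mul_apply, dotProduct, one_apply] using this
  · ext i j
    have := hM i j
    rw [rowVec] at this
    rw [this, mul_apply]
    have hk : ∀ e : Fin r, (α e : ℂ) * (u e i * v e j) =
        (fun c : Fin k => (if hc : c.1 < r then (α ⟨c.1, hc⟩ : ℂ) * u ⟨c.1, hc⟩ i else 0) *
          b (Fin.castLE hkd c) j) (Fin.castLE hr e) := by
      intro e
      have h2 := hb (Fin.castLE hkd (Fin.castLE hr e)) e.2
      simp only [Fin.val_castLE, e.2, dif_pos, h2]
      simp [v', mul_assoc]
    rw [Finset.sum_congr rfl fun e _ => hk e]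
    refine (Finset.sum_of_injOn (Fin.castLE hr) (Fin.castLE_injective hr).injOn (by simp) ?_ ?_)
    · intro c _ hc
      have : ¬ c.1 < r := fun hlt => hc ⟨⟨c.1, hlt⟩, by simp, rfl⟩
      simp [this]
    · intro e _
      rfl

end Schmidt

/-! ### Closedness and separation of the Schmidt cone -/

section Closed

variable {a b : Type*} [Fintype a] [Fintype b]

/-- Rank is lower semicontinuous: the condition of rank at least `k + 1` is open. -/
lemma isClosed_setOf_rank_le (k : ℕ) : IsClosed {M : Matrix a b ℂ | M.rank ≤ k} := by
  classical
  let T : Matrix a b ℂ →ₗ[ℂ] ((b → ℂ) →L[ℂ] (a → ℂ)) :=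
    LinearMap.toContinuousLinearMap.toLinearMap ∘ₗ (Matrix.toLin' (R := ℂ)).toLinearMap
  have hT : Continuous T := T.continuous_of_finiteDimensional
  have hopen := (isOpen_setOfPred_nat_le_rank (𝕜 := ℂ) (E := b → ℂ) (F := a → ℂ)
    (k + 1)).preimage hT
  have hrank : ∀ M : Matrix a b ℂ,
      M ∈ T ⁻¹' {f | ((k + 1 : ℕ) : Cardinal) ≤ (f : (b → ℂ) →ₗ[ℂ] (a → ℂ)).rank} ↔
        k + 1 ≤ M.rank := by
    intro M
    have h1 : ((T M : (b → ℂ) →L[ℂ] (a → ℂ)) : (b → ℂ) →ₗ[ℂ] (a → ℂ)) = M.mulVecLin := rfl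
    rw [Set.mem_preimage, Set.mem_ofPred_eq, h1, LinearMap.rank, ← Module.finrank_eq_rank,
      Nat.cast_le, Matrix.rank]
  have hset : {M : Matrix a b ℂ | M.rank ≤ k}ᶜ =
      T ⁻¹' {f | ((k + 1 : ℕ) : Cardinal) ≤ (f : (b → ℂ) →ₗ[ℂ] (a → ℂ)).rank} := by
    ext M
    rw [hrank, Set.mem_compl_iff, Set.mem_ofPred_eq, not_le, Nat.lt_iff_add_one_le]
  rw [← isOpen_compl_iff, hset]
  exact hopen

/-- Carathéodory: the number of terms in the Schmidt cone is uniformly bounded. -/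
lemma exists_card_mem_schmidtCone (k : ℕ) : ∃ D : ℕ, ∀ ρ ∈ schmidtCone a b k,
    ∃ M : Fin D → Matrix a b ℂ, (∀ l, (M l).rank ≤ k) ∧ ρ = ∑ l, rankOne (M l) := by
  classical
  refine ⟨Module.finrank ℝ (Matrix (a × b) (a × b) ℂ) + 1, fun ρ hρ => ?_⟩
  obtain ⟨q, M, hM, rfl⟩ := mem_schmidtCone_iff.1 hρ
  set T : Set (Matrix (a × b) (a × b) ℂ) := {ρ | ∃ M : Matrix a b ℂ, M.rank ≤ k ∧ ρ = rankOne M}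
    with hT
  -- The generators are stable under nonnegative scaling, so sums of generators are convex
  -- combinations of generators and conversely; this brings in the convex form of Carathéodory's
  -- theorem.
  have hsmul : ∀ x ∈ T, ∀ r : ℝ, 0 ≤ r → r • x ∈ T := by
    rintro _ ⟨M, hM, rfl⟩ r hr
    refine ⟨(Real.sqrt r : ℂ) • M, (rank_smul_le _ _).trans hM, ?_⟩
    rw [rankOne_smul, Real.sq_sqrt hr]
    rfl
  have hhull : ∑ l, rankOne (M l) ∈ convexHull ℝ T := by
    rcases Nat.eq_zero_or_pos q with rfl | hq
    · exact subset_convexHull ℝ T ⟨0, by simp, by simp [rankOne_zero]⟩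
    · have hq' : (0 : ℝ) < q := by exact_mod_cast hq
      have : ∑ l, rankOne (M l) = ∑ l : Fin q, (q : ℝ)⁻¹ • ((q : ℝ) • rankOne (M l)) := by
        refine Finset.sum_congr rfl fun l _ => ?_
        rw [smul_smul, inv_mul_cancel₀ hq'.ne', one_smul]
      rw [this]
      refine (convex_convexHull ℝ T).sum_mem (fun _ _ => by positivity) ?_ fun l _ =>
        subset_convexHull ℝ T (hsmul _ ⟨M l, hM l, rfl⟩ _ hq'.le)
      simp [hq'.ne']
  obtain ⟨ι, _, z, w, hz, hind, hw, -, hsum⟩ := eq_pos_convex_span_of_mem_convexHull hhull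
  have hcard : Fintype.card ι ≤ Module.finrank ℝ (Matrix (a × b) (a × b) ℂ) + 1 :=
    hind.card_le_finrank_succ.trans (Nat.succ_le_succ (Submodule.finrank_le _))
  have hzw : ∀ i, w i • z i ∈ T := fun i => hsmul _ (hz ⟨i, rfl⟩) _ (hw i).le
  choose N hN hNe using hzw
  let g : ι → Fin (Module.finrank ℝ (Matrix (a × b) (a × b) ℂ) + 1) :=
    fun i => Fin.castLE hcard (Fintype.equivFin ι i)
  have hg : Function.Injective g :=
    (Fin.castLE_injective hcard).comp (Fintype.equivFin ι).injective
  -- Unused slots are filled with zero matrices, to reach exactly the uniform number of terms.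
  refine ⟨Function.extend g N 0, fun l => ?_, ?_⟩
  · by_cases hl : ∃ i, g i = l
    · obtain ⟨i, rfl⟩ := hl
      rw [hg.extend_apply]
      exact hN i
    · rw [Function.extend_apply' _ _ _ hl]
      simp
  · rw [← hsum]
    refine Finset.sum_of_injOn g hg.injOn (by simp) ?_ ?_
    · intro l _ hl
      rw [Function.extend_apply' _ _ _ (by simpa using hl)]
      exact rankOne_zero
    · intro i _
      rw [hg.extend_apply]
      exact hNe i

lemma continuous_rankOne : Continuous (rankOne : Matrix a b ℂ → _) := by
  refine continuous_matrix fun x y => ?_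
  simp only [rankOne_apply]
  exact (continuous_id.matrix_elem _ _).mul (continuous_id.matrix_elem _ _).star

lemma re_trace_rankOne (M : Matrix a b ℂ) :
    (rankOne M).trace.re = ∑ i, ∑ j, ‖M i j‖ ^ 2 := by
  simp only [trace, diag_apply, rankOne_apply, Fintype.sum_prod_type, Complex.re_sum]
  refine Finset.sum_congr rfl fun i _ => Finset.sum_congr rfl fun j _ => ?_
  rw [Complex.star_def, Complex.mul_conj, Complex.ofReal_re, Complex.normSq_eq_norm_sq]

/-- The trace of a sum of terms $UU^*$ is the sum of the squared norms of the vectors $U$. With a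
uniformly bounded number of terms, the part of the cone of trace below `R` is thus covered by the
continuous image of a compact set, which contains every limit point of that part and consists of
elements of the cone. -/
lemma isClosed_schmidtCone (k : ℕ) :
    IsClosed (schmidtCone a b k : Set (Matrix (a × b) (a × b) ℂ)) := by
  obtain ⟨D, hD⟩ := exists_card_mem_schmidtCone (a := a) (b := b) k
  let F : (Fin D → a → b → ℂ) → Matrix (a × b) (a × b) ℂ :=
    fun M => ∑ l, rankOne (Matrix.of (M l))
  have hF : Continuous F :=
    continuous_finsetSum _ fun l _ => continuous_rankOne.comp (continuous_apply l)
  have htr : ∀ M, (F M).trace.re = ∑ l, ∑ i, ∑ j, ‖M l i j‖ ^ 2 := by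
    intro M
    simp only [F, trace_sum, Complex.re_sum, re_trace_rankOne, Matrix.of_apply]
  refine isClosed_of_closure_subset fun ρ hρ => ?_
  let R : ℝ := ρ.trace.re + 1
  have hopen : IsOpen {σ : Matrix (a × b) (a × b) ℂ | σ.trace.re < R} :=
    isOpen_lt (Complex.continuous_re.comp continuous_id.matrix_trace) continuous_const
  have hρR : ρ ∈ {σ : Matrix (a × b) (a × b) ℂ | σ.trace.re < R} := by
    simp [R]
  -- The radius `R + 1` avoids a square root: $t^2<R$ implies $t\le R+1$.
  let S : Set (Fin D → a → b → ℂ) :=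
    Metric.closedBall 0 (R + 1) ∩ {M | ∀ l, (Matrix.of (M l)).rank ≤ k}
  have hS : IsCompact S := by
    refine (isCompact_closedBall _ _).inter_right ?_
    simp only [Set.ofPred_forall]
    refine isClosed_iInter fun l => ?_
    exact (isClosed_setOf_rank_le (a := a) (b := b) k).preimage
      (f := fun M : Fin D → a → b → ℂ => Matrix.of (M l)) (continuous_apply l)
  have hsub : {σ : Matrix (a × b) (a × b) ℂ | σ.trace.re < R} ∩ schmidtCone a b k ⊆ F '' S := by
    rintro σ ⟨hσR, hσ⟩
    obtain ⟨M, hM, rfl⟩ := hD σ hσ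
    obtain ⟨M, rfl⟩ : ∃ M' : Fin D → a → b → ℂ, M = fun l => Matrix.of (M' l) :=
      ⟨fun l => M l, rfl⟩
    refine ⟨M, ⟨?_, hM⟩, rfl⟩
    have hσR' : ∑ l, ∑ i, ∑ j, ‖M l i j‖ ^ 2 < R := by
      rw [← htr]; exact hσR
    have hR : 0 ≤ R := le_trans (by positivity) hσR'.le
    rw [mem_closedBall_zero_iff, pi_norm_le_iff_of_nonneg (by linarith)]
    intro l
    rw [pi_norm_le_iff_of_nonneg (by linarith)]
    intro i
    rw [pi_norm_le_iff_of_nonneg (by linarith)]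
    intro j
    have h1 : ‖M l i j‖ ^ 2 ≤ ∑ j, ‖M l i j‖ ^ 2 :=
      Finset.single_le_sum (f := fun j => ‖M l i j‖ ^ 2) (fun _ _ => by positivity)
        (Finset.mem_univ j)
    have h2 : ∑ j, ‖M l i j‖ ^ 2 ≤ ∑ i, ∑ j, ‖M l i j‖ ^ 2 :=
      Finset.single_le_sum (f := fun i => ∑ j, ‖M l i j‖ ^ 2) (fun _ _ => by positivity)
        (Finset.mem_univ i)
    have h3 : ∑ i, ∑ j, ‖M l i j‖ ^ 2 ≤ ∑ l, ∑ i, ∑ j, ‖M l i j‖ ^ 2 :=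
      Finset.single_le_sum (f := fun l => ∑ i, ∑ j, ‖M l i j‖ ^ 2) (fun _ _ => by positivity)
        (Finset.mem_univ l)
    nlinarith [norm_nonneg (M l i j)]
  have hmem : ρ ∈ closure (F '' S) :=
    closure_mono hsub (hopen.inter_closure ⟨hρR, hρ⟩)
  rw [(hS.image hF).isClosed.closure_eq] at hmem
  obtain ⟨M, hM, rfl⟩ := hmem
  exact sum_mem fun l _ => rankOne_mem_schmidtCone (hM.2 l)

lemma convex_schmidtCone (k : ℕ) :
    Convex ℝ (schmidtCone a b k : Set (Matrix (a × b) (a × b) ℂ)) := by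
  intro x hx y hy s t hs ht _
  exact add_mem (smul_mem_schmidtCone hx hs) (smul_mem_schmidtCone hy ht)

/-- A positive matrix outside the Schmidt cone is separated from it by a Hermitian matrix. -/
lemma exists_separating_matrix {k : ℕ} {ρ : Matrix (a × b) (a × b) ℂ} (hρ : ρ.IsHermitian)
    (h : ρ ∉ schmidtCone a b k) :
    ∃ G : Matrix (a × b) (a × b) ℂ,
      (∀ M : Matrix a b ℂ, M.rank ≤ k → 0 ≤ ∑ x, ∑ y, G x y * rankOne M x y) ∧
        ¬ 0 ≤ ∑ x, ∑ y, G x y * ρ x y := by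
  classical
  have : LocallyConvexSpace ℝ (Matrix (a × b) (a × b) ℂ) :=
    inferInstanceAs (LocallyConvexSpace ℝ (a × b → a × b → ℂ))
  obtain ⟨f, u, hfu, hfc⟩ := RCLike.geometric_hahn_banach_point_closed (𝕜 := ℂ)
    (convex_schmidtCone k) (isClosed_schmidtCone k) h
  change (f ρ).re < u at hfu
  change ∀ σ ∈ (schmidtCone a b k : Set _), u < (f σ).re at hfc
  have hu : u < 0 := by simpa using hfc 0 (zero_mem _)
  let F : Matrix (a × b) (a × b) ℂ := Matrix.of fun x y => f (Matrix.single x y 1)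
  have hF : ∀ Z : Matrix (a × b) (a × b) ℂ, f Z = ∑ x, ∑ y, F x y * Z x y := by
    intro Z
    conv_lhs => rw [matrix_eq_sum_single Z]
    simp only [map_sum]
    refine Finset.sum_congr rfl fun x _ => Finset.sum_congr rfl fun y _ => ?_
    have : Matrix.single x y (Z x y) = Z x y • Matrix.single x y (1 : ℂ) := by simp
    rw [this, map_smul, smul_eq_mul, mul_comm]
    rfl
  -- Hahn–Banach controls only the real part of `f`; adding the adjoint makes the pairing with
  -- Hermitian matrices equal to twice that real part.
  have hG : ∀ Z : Matrix (a × b) (a × b) ℂ, Z.IsHermitian →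
      ∑ x, ∑ y, (F + Fᴴ) x y * Z x y = ((2 * (f Z).re : ℝ) : ℂ) := by
    intro Z hZ
    have h1 : ∑ x, ∑ y, Fᴴ x y * Z x y = star (f Z) := by
      rw [hF, star_sum, Finset.sum_comm]
      refine Finset.sum_congr rfl fun x _ => ?_
      rw [star_sum]
      refine Finset.sum_congr rfl fun y _ => ?_
      rw [star_mul', conjTranspose_apply, hZ.apply]
    simp only [Matrix.add_apply, add_mul, Finset.sum_add_distrib, h1, ← hF]
    rw [Complex.star_def, Complex.add_conj]
  refine ⟨F + Fᴴ, fun M hM => ?_, ?_⟩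
  · rw [hG _ (rankOne_posSemidef M).isHermitian]
    by_contra hneg
    have hneg' : (f (rankOne M)).re < 0 := by
      by_contra h0
      exact hneg (by exact_mod_cast (by linarith : (0 : ℝ) ≤ 2 * (f (rankOne M)).re))
    -- If `f` had negative real part on a generator, a nonnegative multiple of the generator would
    -- attain the value `u` exactly, against the strict bound on the cone.
    have := hfc _ (smul_mem_schmidtCone (rankOne_mem_schmidtCone hM)
      (r := u / (f (rankOne M)).re) (div_nonneg_of_nonpos hu.le hneg'.le))
    rw [map_smul, smul_eq_mul, Complex.re_ofReal_mul, div_mul_cancel₀ _ hneg'.ne] at this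
    exact lt_irrefl _ this
  · rw [hG _ hρ]
    intro h0
    have : (0 : ℝ) ≤ 2 * (f ρ).re := by exact_mod_cast h0
    linarith

end Closed

/-! ### Choi matrices, Kraus operators and the cones of OMIN and OMAX -/

section Choi

/-- The scalar block matrix of a matrix of matrices. -/
def flatten {a b : Type*} (X : Matrix a a (Matrix b b ℂ)) : Matrix (a × b) (a × b) ℂ :=
  comp a a b b ℂ X

/-- The matrix of blocks of a scalar block matrix. -/
def unflatten {a b : Type*} (Z : Matrix (a × b) (a × b) ℂ) : Matrix a a (Matrix b b ℂ) :=
  (comp a a b b ℂ).symm Z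

lemma flatten_apply {a b : Type*} (X : Matrix a a (Matrix b b ℂ)) (x y : a × b) :
    flatten X x y = X x.1 y.1 x.2 y.2 := rfl

lemma unflatten_apply {a b : Type*} (Z : Matrix (a × b) (a × b) ℂ) (i j : a) (g h : b) :
    unflatten Z i j g h = Z (i, g) (j, h) := rfl

lemma flatten_unflatten {a b : Type*} (Z : Matrix (a × b) (a × b) ℂ) :
    flatten (unflatten Z) = Z := rfl

lemma flatten_injective {a b : Type*} :
    Function.Injective (flatten : Matrix a a (Matrix b b ℂ) → _) :=
  (comp a a b b ℂ).injective

lemma mem_matCones_iff {n d : ℕ} {X : Matrix (Fin n) (Fin n) (Matrix (Fin d) (Fin d) ℂ)} :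
    X ∈ matCones d n ↔ (flatten X).PosSemidef := Iff.rfl

variable {p m n k d : ℕ}

/-- The Choi matrix `(φ(E_ij))`. -/
def choiMatrix (φ : Matrix (Fin p) (Fin p) ℂ →ₗ[ℂ] Matrix (Fin m) (Fin m) ℂ) :
    Matrix (Fin p × Fin m) (Fin p × Fin m) ℂ :=
  flatten (Matrix.of fun i j => φ (Matrix.single i j 1))

/-- The map `X ↦ V* X V`. -/
def conjugationMap (V : Matrix (Fin p) (Fin m) ℂ) :
    Matrix (Fin p) (Fin p) ℂ →ₗ[ℂ] Matrix (Fin m) (Fin m) ℂ where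
  toFun X := Vᴴ * X * V
  map_add' X Y := by rw [Matrix.mul_add, Matrix.add_mul]
  map_smul' c X := by simp

lemma linearMap_apply_entry (φ : Matrix (Fin p) (Fin p) ℂ →ₗ[ℂ] Matrix (Fin m) (Fin m) ℂ)
    (X : Matrix (Fin p) (Fin p) ℂ) (a b : Fin m) :
    φ X a b = ∑ i, ∑ j, X i j * choiMatrix φ (i, a) (j, b) := by
  conv_lhs => rw [matrix_eq_sum_single X]
  simp only [map_sum, Matrix.sum_apply]
  refine Finset.sum_congr rfl fun x _ => Finset.sum_congr rfl fun y _ => ?_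
  have : Matrix.single x y (X x y) = X x y • Matrix.single x y (1 : ℂ) := by simp
  rw [this, map_smul]
  rfl

lemma conjTranspose_mul_mul_entry (A X : Matrix (Fin p) (Fin m) ℂ) (Y : Matrix (Fin p) (Fin p) ℂ)
    (a b : Fin m) :
    (Aᴴ * Y * X) a b = ∑ i, ∑ j, Y i j * (star (A i a) * X j b) := by
  simp only [mul_apply, Finset.sum_mul, conjTranspose_apply]
  rw [Finset.sum_comm]
  exact Finset.sum_congr rfl fun _ _ => Finset.sum_congr rfl fun _ _ => by ring

/-- Kraus decompositions with operators of rank at most `k` correspond to Choi matrices of Schmidt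
number at most `k`. -/
lemma exists_kraus_iff (φ : Matrix (Fin p) (Fin p) ℂ →ₗ[ℂ] Matrix (Fin m) (Fin m) ℂ) :
    (∃ (q : ℕ) (A : Fin q → Matrix (Fin p) (Fin m) ℂ),
        (∀ l, (A l).rank ≤ k) ∧ ∀ X, φ X = ∑ l, (A l)ᴴ * X * A l) ↔
      choiMatrix φ ∈ schmidtCone (Fin p) (Fin m) k := by
  constructor
  · rintro ⟨q, A, hA, hφ⟩
    -- The $(a,b)$ entry of $A^*E_{ij}A$ is $\overline{A_{ia}}A_{jb}$, hence the entrywise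
    -- conjugate.
    refine mem_schmidtCone_iff.2 ⟨q, fun l => (A l).map star,
      fun l => (rank_map_star _).trans_le (hA l), ?_⟩
    ext ⟨i, a⟩ ⟨j, b⟩
    rw [choiMatrix, flatten_apply, Matrix.of_apply, hφ, Matrix.sum_apply, Matrix.sum_apply]
    refine Finset.sum_congr rfl fun l _ => ?_
    rw [conjTranspose_mul_mul_entry, rankOne_apply]
    simp [single_apply, ite_and]
  · intro h
    obtain ⟨q, M, hM, hC⟩ := mem_schmidtCone_iff.1 h
    refine ⟨q, fun l => (M l).map star, fun l => (rank_map_star _).trans_le (hM l), fun X => ?_⟩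
    ext a b
    rw [linearMap_apply_entry, hC, Matrix.sum_apply]
    simp only [conjTranspose_mul_mul_entry, Matrix.sum_apply, Finset.mul_sum, rankOne_apply,
      map_apply, star_star]
    rw [Finset.sum_congr rfl fun i _ => Finset.sum_comm]
    exact Finset.sum_comm

lemma exists_kraus_of_posSemidef {φ : Matrix (Fin p) (Fin p) ℂ →ₗ[ℂ] Matrix (Fin m) (Fin m) ℂ}
    (h : (choiMatrix φ).PosSemidef) :
    ∃ (q : ℕ) (V : Fin q → Matrix (Fin p) (Fin m) ℂ), ∀ X, φ X = ∑ l, (V l)ᴴ * X * V l := by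
  obtain ⟨q, M, hM⟩ := exists_eq_sum_rankOne h
  -- The rank bound `m` is no restriction on `p × m` matrices.
  have hmem : choiMatrix φ ∈ schmidtCone (Fin p) (Fin m) m := by
    rw [hM]
    exact sum_mem fun l _ => rankOne_mem_schmidtCone (rank_le_width _)
  obtain ⟨r, A, -, hA⟩ := (exists_kraus_iff φ).2 hmem
  exact ⟨r, A, hA⟩

lemma flatten_map_conj (V : Matrix (Fin p) (Fin m) ℂ)
    (X : Matrix (Fin n) (Fin n) (Matrix (Fin p) (Fin p) ℂ)) :
    flatten (X.map fun Y => Vᴴ * Y * V) =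
      (kron (1 : Matrix (Fin n) (Fin n) ℂ) V)ᴴ * flatten X * kron (1 : Matrix (Fin n) (Fin n) ℂ) V := by
  ext ⟨i, a⟩ ⟨j, b⟩
  rw [flatten_apply, map_apply, conjTranspose_mul_mul_entry]
  simp only [mul_apply, conjTranspose_apply, kron_apply, one_apply,
    Fintype.sum_prod_type, flatten_apply, ite_mul, mul_ite, one_mul, zero_mul, mul_zero, apply_ite star,
    star_zero, Finset.sum_ite_irrel, Finset.sum_const_zero, Finset.sum_ite_eq',
    Finset.mem_univ, if_true, Finset.sum_mul]
  rw [Finset.sum_comm]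
  exact Finset.sum_congr rfl fun _ _ => Finset.sum_congr rfl fun _ _ => by ring

lemma flatten_map_of_kraus {φ : Matrix (Fin p) (Fin p) ℂ →ₗ[ℂ] Matrix (Fin m) (Fin m) ℂ} {q : ℕ}
    {V : Fin q → Matrix (Fin p) (Fin m) ℂ} (h : ∀ X, φ X = ∑ l, (V l)ᴴ * X * V l)
    (X : Matrix (Fin n) (Fin n) (Matrix (Fin p) (Fin p) ℂ)) :
    flatten (X.map φ) =
      ∑ l, (kron (1 : Matrix (Fin n) (Fin n) ℂ) (V l))ᴴ * flatten X * kron (1 : Matrix (Fin n) (Fin n) ℂ) (V l) := by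
  simp only [← flatten_map_conj]
  ext ⟨i, a⟩ ⟨j, b⟩
  simp [flatten_apply, h, Matrix.sum_apply]

lemma dotProduct_conjTranspose_mul_mul {a b : Type*} [Fintype a] [Fintype b] (K : Matrix a b ℂ)
    (Z : Matrix a a ℂ) (w : b → ℂ) :
    star w ⬝ᵥ ((Kᴴ * Z * K) *ᵥ w) = star (K *ᵥ w) ⬝ᵥ (Z *ᵥ (K *ᵥ w)) := by
  rw [star_mulVec, ← dotProduct_mulVec, mulVec_mulVec, mulVec_mulVec, Matrix.mul_assoc]

lemma dotProduct_rowVec_one (Z : Matrix (Fin m) (Fin m) (Matrix (Fin m) (Fin m) ℂ)) :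
    star (rowVec (1 : Matrix (Fin m) (Fin m) ℂ)) ⬝ᵥ
      (flatten Z *ᵥ rowVec (1 : Matrix (Fin m) (Fin m) ℂ)) = ∑ a, ∑ b, Z a b a b := by
  simp [dotProduct, mulVec, Fintype.sum_prod_type, rowVec, flatten_apply, one_apply, apply_ite]

lemma sum_mul_rankOne {a b : Type*} [Fintype a] [Fintype b] (Z : Matrix (a × b) (a × b) ℂ)
    (M : Matrix a b ℂ) :
    ∑ x, ∑ y, Z x y * rankOne M x y =
      star (rowVec (M.map star)) ⬝ᵥ (Z *ᵥ rowVec (M.map star)) := by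
  simp only [dotProduct, mulVec, Finset.mul_sum]
  refine Finset.sum_congr rfl fun x _ => Finset.sum_congr rfl fun y _ => ?_
  simp [rankOne_apply, rowVec]
  ring

/-- A positive pairing of the amplification of `φ` with a maximally entangled vector. -/
lemma sum_mul_choiMatrix_nonneg
    {φ : Matrix (Fin p) (Fin p) ℂ →ₗ[ℂ] Matrix (Fin m) (Fin m) ℂ}
    {X : Matrix (Fin m) (Fin m) (Matrix (Fin p) (Fin p) ℂ)} (h : X.map φ ∈ matCones m m) :
    0 ≤ ∑ x : Fin p × Fin m, ∑ y : Fin p × Fin m, X x.2 y.2 x.1 y.1 * choiMatrix φ x y := by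
  have h1 := (mem_matCones_iff.1 h).dotProduct_mulVec_nonneg (rowVec 1)
  rw [dotProduct_rowVec_one] at h1
  convert h1 using 1
  simp only [map_apply, linearMap_apply_entry, Fintype.sum_prod_type]
  rw [Finset.sum_comm]
  refine Finset.sum_congr rfl fun a _ => ?_
  rw [Finset.sum_congr rfl fun i _ => Finset.sum_comm, Finset.sum_comm]

/-- A `k`-positive map into `M_k` has a positive Choi matrix. -/
lemma choiMatrix_posSemidef {φ : Matrix (Fin p) (Fin p) ℂ →ₗ[ℂ] Matrix (Fin m) (Fin m) ℂ}
    (h : ∀ A ∈ matCones p m, A.map φ ∈ matCones m m) : (choiMatrix φ).PosSemidef := by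
  refine posSemidef_of_forall_nonneg fun v => ?_
  obtain ⟨w, rfl⟩ := exists_rowVec_eq v
  have hY : unflatten (rankOne wᴴ) ∈ matCones p m := by
    change (flatten (unflatten (rankOne wᴴ))).PosSemidef
    rw [flatten_unflatten]
    exact rankOne_posSemidef _
  convert sum_mul_choiMatrix_nonneg (h _ hY) using 1
  simp only [dotProduct, mulVec, Finset.mul_sum]
  refine Finset.sum_congr rfl fun x _ => Finset.sum_congr rfl fun y _ => ?_
  simp [rankOne_apply, rowVec, unflatten_apply]
  ring

lemma flatten_add_smul_one (X : Matrix (Fin n) (Fin n) (Matrix (Fin d) (Fin d) ℂ)) (r : ℂ) :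
    flatten (r • Matrix.diagonal (fun _ => 1) + X) = r • 1 + flatten X := by
  ext ⟨i, a⟩ ⟨j, b⟩
  by_cases hij : i = j <;> by_cases hab : a = b <;> simp [hij, hab, one_apply, flatten_apply]

lemma flatten_scalarSandwich {q : ℕ} (A : Matrix (Fin n) (Fin k × Fin q) ℂ)
    (D : Fin q → Matrix (Fin k) (Fin k) (Matrix (Fin d) (Fin d) ℂ)) :
    flatten (scalarSandwich A (blockDiagonal D) Aᴴ) =
      ∑ l, kron (Matrix.of fun i c => A i (c, l)) (1 : Matrix (Fin d) (Fin d) ℂ) *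
        flatten (D l) * (kron (Matrix.of fun i c => A i (c, l)) (1 : Matrix (Fin d) (Fin d) ℂ))ᴴ := by
  ext ⟨i, a⟩ ⟨j, b⟩
  rw [Matrix.sum_apply]
  have hR : ∀ l, (kron (Matrix.of fun i c => A i (c, l)) (1 : Matrix (Fin d) (Fin d) ℂ) *
      flatten (D l) * (kron (Matrix.of fun i c => A i (c, l)) (1 : Matrix (Fin d) (Fin d) ℂ))ᴴ) (i, a) (j, b) =
      ∑ c, ∑ e, A i (c, l) * star (A j (e, l)) * D l c e a b := by
    intro l
    simp only [mul_apply, conjTranspose_apply, kron_apply, one_apply, Matrix.of_apply,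
      Fintype.sum_prod_type, flatten_apply, ite_mul, mul_ite, mul_one, zero_mul, mul_zero,
      apply_ite star, star_zero,
      Finset.sum_ite_eq, Finset.mem_univ, if_true, Finset.sum_mul]
    rw [Finset.sum_comm]
    exact Finset.sum_congr rfl fun _ _ => Finset.sum_congr rfl fun _ _ => by ring
  simp only [hR]
  simp only [flatten_apply, scalarSandwich, Matrix.of_apply, Matrix.sum_apply, Fintype.sum_prod_type,
    blockDiagonal_apply, Matrix.smul_apply, conjTranspose_apply, smul_eq_mul]
  rw [Finset.sum_comm]
  refine Finset.sum_congr rfl fun l _ => Finset.sum_congr rfl fun c _ =>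
    Finset.sum_congr rfl fun e _ => ?_
  rw [Finset.sum_eq_single l] <;> simp +contextual [eq_comm]

/-- Each diagonal block contributes a conjugation by $A_l\otimes 1$ with $A_l$ of width `k`.
Conversely, a coefficient matrix $M=WB^T$ of rank at most `k` gives $UU^*$ as the conjugate by
$W\otimes1$ of the rank-one block attached to $B^T$. -/
lemma mem_kMaxPreCones_iff (hkd : k ≤ d)
    {X : Matrix (Fin n) (Fin n) (Matrix (Fin d) (Fin d) ℂ)} :
    X ∈ kMaxPreCones k (matCones d) n ↔
      flatten X ∈ schmidtCone (Fin n) (Fin d) k := by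
  constructor
  · rintro ⟨q, A, D, hD, rfl⟩
    rw [flatten_scalarSandwich]
    refine sum_mem fun l _ => kron_mul_mem_schmidtCone _ _ (fun W => ?_) (hD l)
    rw [Matrix.mul_assoc]
    exact (rank_mul_le_left _ _).trans (rank_le_width _)
  · intro h
    obtain ⟨q, M, hM, hX⟩ := mem_schmidtCone_iff.1 h
    choose W B _ hMW using fun l => exists_isometry_factorization hkd (M l) (hM l)
    refine ⟨q, Matrix.of fun i x => W x.2 i x.1,
      fun l => unflatten (rankOne (B l)ᵀ), fun l => ?_, ?_⟩
    · change (flatten (unflatten (rankOne (B l)ᵀ))).PosSemidef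
      rw [flatten_unflatten]
      exact rankOne_posSemidef _
    · apply flatten_injective
      rw [flatten_scalarSandwich, hX]
      refine Finset.sum_congr rfl fun l _ => ?_
      rw [flatten_unflatten]
      have := kron_mul_rankOne (W l) (1 : Matrix (Fin d) (Fin d) ℂ) (B l)ᵀ
      rw [transpose_one, Matrix.mul_one, ← hMW] at this
      exact this.symm

lemma one_mem_schmidtCone (hk : 1 ≤ k) :
    (1 : Matrix (Fin n × Fin d) (Fin n × Fin d) ℂ) ∈ schmidtCone (Fin n) (Fin d) k := by
  have : (1 : Matrix (Fin n × Fin d) (Fin n × Fin d) ℂ) =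
      ∑ x : Fin n × Fin d, rankOne (Matrix.single x.1 x.2 (1 : ℂ)) := by
    ext ⟨i, a⟩ ⟨j, b⟩
    rw [Matrix.sum_apply, Finset.sum_eq_single (i, a)]
    · simp [rankOne_apply, single_apply, one_apply]
    · intro x _ hx
      have : ¬ (x.1 = i ∧ x.2 = a) := fun h => hx (Prod.ext h.1 h.2)
      simp [rankOne_apply, single_apply, this]
    · simp
  rw [this]
  refine sum_mem fun x _ => rankOne_mem_schmidtCone (le_trans ?_ hk)
  rw [single_eq_single_vecMulVec_single]
  exact rank_vecMulVec_le _ _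

/-- The identity lies in the Schmidt cone and the cone is closed, so the Archimedeanization adds
nothing. -/
lemma mem_OMAX_iff (hk : 1 ≤ k) (hkd : k ≤ d)
    {X : Matrix (Fin n) (Fin n) (Matrix (Fin d) (Fin d) ℂ)} :
    X ∈ OMAX k d n ↔ flatten X ∈ schmidtCone (Fin n) (Fin d) k := by
  have hr : ∀ r : ℝ, (r : ℂ) • Matrix.diagonal (fun _ => (1 : Matrix (Fin d) (Fin d) ℂ)) + X ∈
      kMaxPreCones k (matCones d) n ↔ (r : ℂ) • 1 + flatten X ∈
        schmidtCone (Fin n) (Fin d) k := fun r => by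
    rw [mem_kMaxPreCones_iff hkd, flatten_add_smul_one]
  constructor
  · intro h
    have hlim : Filter.Tendsto (fun t : ℕ => (((1 / ((t : ℝ) + 1) : ℝ)) : ℂ) •
        (1 : Matrix (Fin n × Fin d) (Fin n × Fin d) ℂ) + flatten X) Filter.atTop
        (nhds (((0 : ℝ) : ℂ) • 1 + flatten X)) :=
      ((((Complex.continuous_ofReal.tendsto _).comp
        tendsto_one_div_add_atTop_nhds_zero_nat).smul_const _).add_const _)
    rw [Complex.ofReal_zero, zero_smul, zero_add] at hlim
    exact (isClosed_schmidtCone k).mem_of_tendsto hlim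
      (Filter.Eventually.of_forall fun t => (hr _).1 (h _ (by positivity)))
  · intro h r hr0
    exact (hr r).2 (add_mem (smul_mem_schmidtCone (one_mem_schmidtCone hk) hr0.le) h)

/-- A vector with coefficient matrix $WB^T$, $B$ an isometry, is seen by the unital map $Y\mapsto
B^*YB$ tested at $W$. Conversely, a `k`-positive map into $M_k$ has Kraus operators $V$, and testing
at $w$ amounts to testing `X` at $wV^T$, which passes through $\mathbb C^k$. -/
lemma mem_OMIN_iff (hkd : k ≤ d)
    {X : Matrix (Fin n) (Fin n) (Matrix (Fin d) (Fin d) ℂ)} :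
    X ∈ OMIN k d n ↔ ∀ M : Matrix (Fin n) (Fin d) ℂ, M.rank ≤ k →
      0 ≤ star (rowVec M) ⬝ᵥ (flatten X *ᵥ rowVec M) := by
  constructor
  · intro h M hM
    obtain ⟨W, B, hB, rfl⟩ := exists_isometry_factorization hkd M hM
    have hmem : conjugationMap B ∈ unitalKPositiveMaps k (matCones d) 1 := by
      refine ⟨by simp [conjugationMap, hB], fun A hA => ?_⟩
      change (flatten (A.map fun Y => Bᴴ * Y * B)).PosSemidef
      rw [flatten_map_conj]
      exact PosSemidef.conjTranspose_mul_mul_same hA _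
    have h1 : (flatten (X.map fun Y => Bᴴ * Y * B)).PosSemidef := h _ hmem
    have h2 := h1.dotProduct_mulVec_nonneg (rowVec W)
    rw [flatten_map_conj, dotProduct_conjTranspose_mul_mul, kron_mulVec_rowVec,
      Matrix.one_mul] at h2
    exact h2
  · rintro h ψ ⟨-, hψ⟩
    obtain ⟨q, V, hV⟩ := exists_kraus_of_posSemidef (choiMatrix_posSemidef hψ)
    change (flatten (X.map ψ)).PosSemidef
    rw [flatten_map_of_kraus hV]
    refine posSemidef_sum _ fun l _ => posSemidef_of_forall_nonneg fun v => ?_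
    obtain ⟨w, rfl⟩ := exists_rowVec_eq v
    rw [dotProduct_conjTranspose_mul_mul, kron_mulVec_rowVec, Matrix.one_mul]
    exact h _ ((rank_mul_le_left _ _).trans (rank_le_width _))

lemma matCones_subset_OMIN (hkd : k ≤ d)
    {X : Matrix (Fin n) (Fin n) (Matrix (Fin d) (Fin d) ℂ)} (h : X ∈ matCones d n) :
    X ∈ OMIN k d n :=
  (mem_OMIN_iff hkd).2 fun M _ => PosSemidef.dotProduct_mulVec_nonneg h (rowVec M)

end Choi

/-! ### Positive functionals and their density matrices -/

section Functionals

variable {p m n k d : ℕ}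

lemma functional_apply (f : BipartiteFunctional n d)
    (A : Matrix (Fin n) (Fin n) (Matrix (Fin d) (Fin d) ℂ)) :
    f A = ∑ x, ∑ y, flatten A x y * densityMatrix f x y := by
  have hsingle : ∀ i j (g h : Fin d), Matrix.single i j (Matrix.single g h (A i j g h)) =
      A i j g h • (Matrix.single i j (Matrix.single g h (1 : ℂ)) :
        Matrix (Fin n) (Fin n) (Matrix (Fin d) (Fin d) ℂ)) := by
    intro i j g h
    simp
  have hA : A = ∑ i, ∑ j, ∑ g, ∑ h, A i j g h •
      (Matrix.single i j (Matrix.single g h (1 : ℂ)) :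
        Matrix (Fin n) (Fin n) (Matrix (Fin d) (Fin d) ℂ)) := by
    simp only [← hsingle]
    conv_lhs => rw [matrix_eq_sum_single A]
    refine Finset.sum_congr rfl fun i _ => Finset.sum_congr rfl fun j _ => ?_
    have := congrArg (Matrix.singleAddMonoidHom i j) (matrix_eq_sum_single (A i j))
    simpa only [map_sum, Matrix.singleAddMonoidHom_apply] using this
  conv_lhs => rw [hA]
  simp only [map_sum, map_smul, Fintype.sum_prod_type, flatten_apply, densityMatrix,
    Matrix.of_apply, smul_eq_mul]
  exact Finset.sum_congr rfl fun i _ => Finset.sum_comm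

lemma functional_one (f : BipartiteFunctional n d) : f 1 = (densityMatrix f).trace := by
  have h1 : flatten (1 : Matrix (Fin n) (Fin n) (Matrix (Fin d) (Fin d) ℂ)) = 1 := by
    ext ⟨i, a⟩ ⟨j, b⟩
    by_cases hij : i = j <;> by_cases hab : a = b <;> simp [hij, hab, one_apply, flatten_apply]
  rw [functional_apply, h1]
  simp [one_apply, trace]

lemma densityMatrix_smul (c : ℂ) (f : BipartiteFunctional n d) :
    densityMatrix (c • f) = c • densityMatrix f := rfl

lemma densityMatrix_posSemidef {f : BipartiteFunctional n d} (hf : IsPositiveFunctional f) :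
    (densityMatrix f).PosSemidef := by
  refine posSemidef_of_forall_nonneg fun v => ?_
  obtain ⟨w, rfl⟩ := exists_rowVec_eq v
  have h := hf (unflatten (rankOne (w.map star)))
    (mem_matCones_iff.2 (by rw [flatten_unflatten]; exact rankOne_posSemidef _))
  rw [functional_apply, flatten_unflatten] at h
  convert h using 1
  simp only [dotProduct, mulVec, Finset.mul_sum]
  refine Finset.sum_congr rfl fun x _ => Finset.sum_congr rfl fun y _ => ?_
  simp [rankOne_apply, rowVec]
  ring

lemma isPositiveFunctional_of_posSemidef {f : BipartiteFunctional n d}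
    (h : (densityMatrix f).PosSemidef) : IsPositiveFunctional f := by
  intro A hA
  obtain ⟨q, M, hM⟩ := exists_eq_sum_rankOne h
  rw [functional_apply, hM]
  have : ∑ x, ∑ y, flatten A x y * (∑ l, rankOne (M l)) x y =
      ∑ l, ∑ x, ∑ y, flatten A x y * rankOne (M l) x y := by
    simp only [Matrix.sum_apply, Finset.mul_sum]
    rw [Finset.sum_congr rfl fun i _ => Finset.sum_comm]
    exact Finset.sum_comm
  rw [this]
  refine Finset.sum_nonneg fun l _ => ?_
  rw [sum_mul_rankOne]
  exact (mem_matCones_iff.1 hA).dotProduct_mulVec_nonneg _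

/-- Normalization is immaterial in a cone, and $f(I)$ is the trace of the density matrix. -/
lemma isKSeparable_iff {f : BipartiteFunctional n d} :
    IsKSeparable k f ↔ densityMatrix f ∈ schmidtCone (Fin n) (Fin d) k := by
  constructor
  · rintro ⟨hf, rfl | ⟨hs, hk⟩⟩
    · have : densityMatrix (0 : BipartiteFunctional n d) = 0 := rfl
      rw [this]
      exact zero_mem _
    · rw [schmidtNumberLE_iff, densityMatrix_smul] at hk
      have h1 : f 1 ≠ 0 := fun h0 => by
        have := hs.2
        simp [h0] at this
      have hnn : 0 ≤ f 1 := by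
        rw [functional_one]; exact (densityMatrix_posSemidef hf).trace_nonneg
      obtain ⟨hre, him⟩ := Complex.le_def.1 hnn
      have hr : ((f 1).re : ℂ) = f 1 := Complex.ext (by simp) (by simpa using him)
      have := smul_mem_schmidtCone hk (r := (f 1).re) (by simpa using hre)
      rwa [hr, smul_smul, mul_inv_cancel₀ h1, one_smul] at this
  · intro h
    have hP := posSemidef_of_mem_schmidtCone h
    have hf := isPositiveFunctional_of_posSemidef hP
    refine ⟨hf, ?_⟩
    have hnn : 0 ≤ f 1 := by rw [functional_one]; exact hP.trace_nonneg
    obtain ⟨hre, him⟩ := Complex.le_def.1 hnn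
    have hr : ((f 1).re : ℂ) = f 1 := Complex.ext (by simp) (by simpa using him)
    have hmem : densityMatrix ((f 1)⁻¹ • f) ∈ schmidtCone (Fin n) (Fin d) k := by
      rw [densityMatrix_smul, ← hr, ← Complex.ofReal_inv]
      exact smul_mem_schmidtCone h (inv_nonneg.2 (by simpa using hre))
    -- A positive semidefinite matrix of trace zero vanishes, so here `f = 0`.
    by_cases h0 : f 1 = 0
    · left
      have hz : densityMatrix f = 0 := by
        rw [functional_one] at h0
        exact hP.trace_eq_zero_iff.1 h0
      ext1 A
      rw [functional_apply, hz]
      simp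
    · right
      refine ⟨⟨isPositiveFunctional_of_posSemidef (posSemidef_of_mem_schmidtCone hmem), ?_⟩,
        schmidtNumberLE_iff.2 hmem⟩
      simp [h0]

lemma densityMatrix_comp_mapMatrix
    {φ : Matrix (Fin p) (Fin p) ℂ →ₗ[ℂ] Matrix (Fin m) (Fin m) ℂ} {q : ℕ}
    {A : Fin q → Matrix (Fin p) (Fin m) ℂ} (h : ∀ X, φ X = ∑ l, (A l)ᴴ * X * A l)
    (s : BipartiteFunctional n m) :
    densityMatrix (s ∘ₗ φ.mapMatrix) =
      ∑ l, kron (1 : Matrix (Fin n) (Fin n) ℂ) ((A l).map star) * densityMatrix s *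
        (kron (1 : Matrix (Fin n) (Fin n) ℂ) ((A l).map star))ᴴ := by
  ext ⟨i, g⟩ ⟨j, h'⟩
  have hL : densityMatrix (s ∘ₗ φ.mapMatrix) (i, g) (j, h') =
      s (Matrix.single i j (φ (Matrix.single g h' 1))) := by
    simp [densityMatrix, LinearMap.mapMatrix_apply]
  rw [hL, functional_apply, Matrix.sum_apply]
  have hR : ∀ l, (kron (1 : Matrix (Fin n) (Fin n) ℂ) ((A l).map star) * densityMatrix s *
        (kron (1 : Matrix (Fin n) (Fin n) ℂ) ((A l).map star))ᴴ) (i, g) (j, h') =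
      ∑ a, ∑ b, star (A l g a) * A l h' b * densityMatrix s (i, a) (j, b) := by
    intro l
    simp only [mul_apply, conjTranspose_apply, kron_apply, one_apply, map_apply,
      Fintype.sum_prod_type, ite_mul, mul_ite, one_mul, zero_mul, mul_zero,
      apply_ite star, star_zero, star_star, Finset.sum_ite_irrel, Finset.sum_const_zero,
      Finset.sum_ite_eq, Finset.mem_univ, if_true, Finset.sum_mul]
    rw [Finset.sum_comm]
    exact Finset.sum_congr rfl fun _ _ => Finset.sum_congr rfl fun _ _ => by ring
  have hφ : ∀ a b, φ (Matrix.single g h' 1) a b = ∑ l, star (A l g a) * A l h' b := by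
    intro a b
    rw [h, Matrix.sum_apply]
    refine Finset.sum_congr rfl fun l _ => ?_
    rw [conjTranspose_mul_mul_entry]
    simp [single_apply, ite_and]
  have hsum : ∑ l, ∑ a, ∑ b, star (A l g a) * A l h' b * densityMatrix s (i, a) (j, b) =
      ∑ a, ∑ b, φ (Matrix.single g h' 1) a b * densityMatrix s (i, a) (j, b) := by
    simp only [hφ, Finset.sum_mul]
    rw [Finset.sum_comm]
    exact Finset.sum_congr rfl fun a _ => Finset.sum_comm
  simp only [hR, hsum, Fintype.sum_prod_type, flatten_apply]
  rw [Finset.sum_eq_single i]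
  · refine Finset.sum_congr rfl fun a _ => ?_
    rw [Finset.sum_eq_single j]
    · simp
    · intro x _ hx
      simp [hx.symm]
    · simp
  · intro x _ hx
    simp [hx.symm]
  · simp

lemma submatrix_swap_mem_schmidtCone {ρ : Matrix (Fin n × Fin d) (Fin n × Fin d) ℂ}
    (h : ρ ∈ schmidtCone (Fin n) (Fin d) k) :
    ρ.submatrix Prod.swap Prod.swap ∈ schmidtCone (Fin d) (Fin n) k := by
  obtain ⟨q, M, hM, rfl⟩ := mem_schmidtCone_iff.1 h
  refine mem_schmidtCone_iff.2 ⟨q, fun l => (M l)ᵀ, fun l => (rank_transpose _).trans_le (hM l), ?_⟩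
  ext x y
  simp [Matrix.sum_apply, rankOne_apply]

/-- The functional `X ↦ ∑ (X_ab)_ab` of the maximally entangled vector. -/
def entangledFunctional (m : ℕ) : BipartiteFunctional m m where
  toFun X := ∑ a, ∑ b, X a b a b
  map_add' X Y := by simp [Finset.sum_add_distrib]
  map_smul' c X := by simp [Finset.mul_sum]

lemma isState_entangledFunctional (hm : 1 ≤ m) :
    IsState (((m : ℝ)⁻¹ : ℂ) • entangledFunctional m) := by
  have hm' : (m : ℂ) ≠ 0 := by exact_mod_cast (by omega : m ≠ 0)
  constructor
  · intro A hA
    have h1 := (mem_matCones_iff.1 hA).dotProduct_mulVec_nonneg (rowVec 1)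
    rw [dotProduct_rowVec_one] at h1
    have h2 : (0 : ℂ) ≤ ((m : ℝ)⁻¹ : ℂ) := by
      rw [← Complex.ofReal_inv]
      exact_mod_cast (by positivity : (0 : ℝ) ≤ (m : ℝ)⁻¹)
    exact mul_nonneg h2 h1
  · have : entangledFunctional m 1 = m := by
      change ∑ a : Fin m, ∑ b : Fin m,
        (1 : Matrix (Fin m) (Fin m) (Matrix (Fin m) (Fin m) ℂ)) a b a b = m
      have : ∀ a b : Fin m, (1 : Matrix (Fin m) (Fin m) (Matrix (Fin m) (Fin m) ℂ)) a b a b =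
          if a = b then 1 else 0 := by
        intro a b
        by_cases hab : a = b <;> simp [hab, one_apply]
      simp [this]
    simp [this, hm']

lemma densityMatrix_entangledFunctional
    (φ : Matrix (Fin p) (Fin p) ℂ →ₗ[ℂ] Matrix (Fin m) (Fin m) ℂ) :
    densityMatrix (entangledFunctional m ∘ₗ φ.mapMatrix) =
      (choiMatrix φ).submatrix Prod.swap Prod.swap := by
  ext ⟨i, g⟩ ⟨j, h⟩
  have h1 : densityMatrix (entangledFunctional m ∘ₗ φ.mapMatrix) (i, g) (j, h) =
      ∑ a, ∑ b, (Matrix.single i j (φ (Matrix.single g h 1)) :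
        Matrix (Fin m) (Fin m) (Matrix (Fin m) (Fin m) ℂ)) a b a b := by
    have hmap : φ.mapMatrix (Matrix.single i j (Matrix.single g h 1)) =
        Matrix.single i j (φ (Matrix.single g h 1)) := by
      simp [LinearMap.mapMatrix_apply]
    rw [← hmap]
    rfl
  rw [h1, Finset.sum_eq_single i]
  · rw [Finset.sum_eq_single j]
    · simp [choiMatrix, flatten_apply]
    · intro x _ hx
      simp [hx.symm]
    · simp
  · intro x _ hx
    simp [hx.symm]
  · simp

end Functionals

/-! ### Each condition against membership of the Choi matrix -/

section Equivalences

variable {p m k : ℕ} {φ : Matrix (Fin p) (Fin p) ℂ →ₗ[ℂ] Matrix (Fin m) (Fin m) ℂ}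

lemma isCompletelyPositive_OMIN_OMAX_of_kraus (hk : 1 ≤ k) (hkp : k ≤ p) (hkm : k ≤ m)
    (h : choiMatrix φ ∈ schmidtCone (Fin p) (Fin m) k) :
    IsCompletelyPositive (OMIN k p) (OMAX k m) φ := by
  obtain ⟨q, A, hA, hφ⟩ := (exists_kraus_iff φ).2 h
  intro n X hX
  rw [mem_OMAX_iff hk hkm]
  change flatten (X.map φ) ∈ _
  rw [flatten_map_of_kraus hφ]
  refine sum_mem fun l _ => ?_
  -- Passing through $\mathbb C^k$ is used twice: compression by `W` makes an element of
  -- $\mathrm{OMIN}_k$ positive semidefinite, and conjugation by $1\otimes\overline B$ then puts it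
  -- in the Schmidt cone.
  obtain ⟨W, B, -, hWB⟩ := exists_isometry_factorization hkm (A l) (hA l)
  have hP : ((kron (1 : Matrix (Fin n) (Fin n) ℂ) W)ᴴ * flatten X *
      kron (1 : Matrix (Fin n) (Fin n) ℂ) W).PosSemidef := by
    refine posSemidef_of_forall_nonneg fun v => ?_
    obtain ⟨w, rfl⟩ := exists_rowVec_eq v
    rw [dotProduct_conjTranspose_mul_mul, kron_mulVec_rowVec, Matrix.one_mul]
    exact (mem_OMIN_iff hkp).1 hX _ ((rank_mul_le_left _ _).trans (rank_le_width _))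
  have hfac : kron (1 : Matrix (Fin n) (Fin n) ℂ) (A l) =
      kron (1 : Matrix (Fin n) (Fin n) ℂ) W *
        (kron (1 : Matrix (Fin n) (Fin n) ℂ) (B.map star))ᴴ := by
    have hB : (kron (1 : Matrix (Fin n) (Fin n) ℂ) (B.map star))ᴴ = kron 1 Bᵀ := by
      ext x y
      by_cases hxy : x.1 = y.1
      · simp [kron_apply, one_apply, hxy]
      · simp [kron_apply, one_apply, hxy, Ne.symm hxy]
    rw [hB, hWB]
    simp only [kron, ← mul_kronecker_mul, Matrix.one_mul]
  have := kron_mul_mem_schmidtCone (k := k) (1 : Matrix (Fin n) (Fin n) ℂ) (B.map star)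
    (fun w => (rank_mul_le_left _ _).trans ((rank_mul_le_right _ _).trans (rank_le_width _))) hP
  rw [hfac, conjTranspose_mul, conjTranspose_conjTranspose]
  simpa only [Matrix.mul_assoc] using this

lemma choiMatrix_mem_of_isCompletelyPositive_OMIN (hkp : k ≤ p)
    (h : IsCompletelyPositive (OMIN k p) (matCones m) φ) :
    choiMatrix φ ∈ schmidtCone (Fin p) (Fin m) k := by
  have hP : (choiMatrix φ).PosSemidef :=
    choiMatrix_posSemidef fun A hA => h _ _ (matCones_subset_OMIN hkp hA)
  by_contra hnot
  obtain ⟨G, hG, hneg⟩ := exists_separating_matrix hP.isHermitian hnot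
  -- The separating matrix, with its tensor factors swapped, is an element of $\mathrm{OMIN}_k(M_p)$
  -- at level `m`; its pairing with the Choi matrix contradicts complete positivity.
  let X : Matrix (Fin m) (Fin m) (Matrix (Fin p) (Fin p) ℂ) :=
    unflatten (G.submatrix Prod.swap Prod.swap)
  have hX : X ∈ OMIN k p m := by
    refine (mem_OMIN_iff hkp).2 fun M hM => ?_
    have h1 := hG (M.map star)ᵀ (by rwa [rank_transpose, rank_map_star])
    convert h1 using 1
    rw [← (Equiv.prodComm (Fin m) (Fin p)).sum_comp]
    simp only [dotProduct, mulVec, Finset.mul_sum]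
    refine Finset.sum_congr rfl fun x _ => ?_
    rw [← (Equiv.prodComm (Fin m) (Fin p)).sum_comp]
    refine Finset.sum_congr rfl fun y _ => ?_
    simp [X, flatten_unflatten, rankOne_apply, rowVec]
    ring
  exact hneg (sum_mul_choiMatrix_nonneg (h _ _ hX))

lemma choiMatrix_mem_of_isCompletelyPositive_OMAX (hk : 1 ≤ k) (hkm : k ≤ m)
    (h : IsCompletelyPositive (matCones p) (OMAX k m) φ) :
    choiMatrix φ ∈ schmidtCone (Fin p) (Fin m) k := by
  -- The blocks of this positive matrix are the units $E_{ij}$, so its image under the amplification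
  -- is the Choi matrix.
  have hE : unflatten (rankOne (1 : Matrix (Fin p) (Fin p) ℂ)) ∈ matCones p p :=
    mem_matCones_iff.2 (rankOne_posSemidef _)
  have := (mem_OMAX_iff hk hkm).1 (h _ _ hE)
  convert this using 1
  ext x y
  have h1 : (Matrix.single x.1 y.1 1 : Matrix (Fin p) (Fin p) ℂ) =
      unflatten (rankOne (1 : Matrix (Fin p) (Fin p) ℂ)) x.1 y.1 := by
    ext g h
    by_cases hg : x.1 = g <;> by_cases hh : y.1 = h <;>
      simp [unflatten_apply, rankOne_apply, hg, hh]
  simp [choiMatrix, flatten_apply, h1]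

/-- The maximally entangled state at level `m` pulls back to the Choi matrix, up to a swap and the
factor $1/m$. Conversely, Kraus operators of rank at most `k` conjugate any density matrix into the
Schmidt cone. -/
lemma isKPartiallyEntanglementBreaking_iff (hm : 1 ≤ m) :
    IsKPartiallyEntanglementBreaking k φ ↔ choiMatrix φ ∈ schmidtCone (Fin p) (Fin m) k := by
  constructor
  · intro h
    have h1 := isKSeparable_iff.1 (h m _ (isState_entangledFunctional hm))
    rw [LinearMap.smul_comp, densityMatrix_smul, densityMatrix_entangledFunctional] at h1
    have h2 := submatrix_swap_mem_schmidtCone (smul_mem_schmidtCone h1 (Nat.cast_nonneg m))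
    have hm' : (m : ℂ) ≠ 0 := by exact_mod_cast (by omega : m ≠ 0)
    convert h2 using 1
    ext x y
    simp [hm']
  · intro h n s hs
    obtain ⟨q, A, hA, hφ⟩ := (exists_kraus_iff φ).2 h
    rw [isKSeparable_iff, densityMatrix_comp_mapMatrix hφ]
    refine sum_mem fun l _ => kron_mul_mem_schmidtCone _ _ (fun W => ?_)
      (densityMatrix_posSemidef hs.1)
    refine (rank_mul_le_right _ _).trans ?_
    rw [rank_transpose, rank_map_star]
    exact hA l

lemma exists_completelyPositive_factorization_iff (hkm : k ≤ m) :
    (∃ (q : ℕ) (ψ : Fin q → (Matrix (Fin p) (Fin p) ℂ →ₗ[ℂ] Matrix (Fin k) (Fin k) ℂ))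
        (M : Fin q → Matrix (Fin m) (Fin k) ℂ),
        (∀ l, IsCompletelyPositive (matCones p) (matCones k) (ψ l)) ∧
          ∀ X, φ X = ∑ l, M l * ψ l X * (M l).conjTranspose) ↔
      choiMatrix φ ∈ schmidtCone (Fin p) (Fin m) k := by
  constructor
  · rintro ⟨q, ψ, M, hψ, hφ⟩
    choose r V hV using fun l =>
      exists_kraus_of_posSemidef (choiMatrix_posSemidef fun A hA => hψ l _ A hA)
    have hC : choiMatrix φ = ∑ l, choiMatrix (∑ e : Fin (r l), conjugationMap (V l e * (M l)ᴴ)) := by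
      ext x y
      simp only [choiMatrix, flatten_apply, Matrix.of_apply, Matrix.sum_apply, hφ, hV]
      refine Finset.sum_congr rfl fun l _ => ?_
      have hl : ∀ X, M l * (∑ e, (V l e)ᴴ * X * V l e) * (M l)ᴴ =
          (∑ e : Fin (r l), conjugationMap (V l e * (M l)ᴴ)) X := by
        intro X
        rw [LinearMap.sum_apply, Matrix.mul_sum, Matrix.sum_mul]
        refine Finset.sum_congr rfl fun e _ => ?_
        simp [conjugationMap, Matrix.mul_assoc]
      rw [hl]
    rw [hC]
    refine sum_mem fun l _ => (exists_kraus_iff _).1 ⟨r l, fun e => V l e * (M l)ᴴ, fun e =>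
      (rank_mul_le_left _ _).trans (rank_le_width _), fun X => ?_⟩
    simp only [LinearMap.coe_sum, Finset.sum_apply]
    rfl
  · intro h
    obtain ⟨q, A, hA, hφ⟩ := (exists_kraus_iff φ).2 h
    choose W B _ hWB using fun l => exists_isometry_factorization hkm (A l) (hA l)
    refine ⟨q, fun l => conjugationMap (W l), fun l => (B l).map star, fun l n X hX => ?_,
      fun X => ?_⟩
    · change (flatten (X.map fun Y => (W l)ᴴ * Y * W l)).PosSemidef
      rw [flatten_map_conj]
      exact PosSemidef.conjTranspose_mul_mul_same (mem_matCones_iff.1 hX) _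
    · rw [hφ]
      refine Finset.sum_congr rfl fun l _ => ?_
      have hB : ((B l).map star)ᴴ = (B l)ᵀ := by
        ext; simp
      have hB' : ((B l)ᵀ)ᴴ = (B l).map star := rfl
      rw [hB]
      conv_lhs => rw [hWB l, conjTranspose_mul, hB']
      simp [conjugationMap, Matrix.mul_assoc]

end Equivalences

theorem mainTheorem1 (p m k : ℕ) (hk : 1 ≤ k) (hkpm : k ≤ min p m)
    (φ : Matrix (Fin p) (Fin p) ℂ →ₗ[ℂ] Matrix (Fin m) (Fin m) ℂ) :
    List.TFAE [
      IsCompletelyPositive (OMIN k p) (matCones m) φ,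
      IsKPartiallyEntanglementBreaking k φ,
      IsCompletelyPositive (matCones p) (OMAX k m) φ,
      ∃ (q : ℕ) (ψ : Fin q → (Matrix (Fin p) (Fin p) ℂ →ₗ[ℂ] Matrix (Fin k) (Fin k) ℂ))
        (M : Fin q → Matrix (Fin m) (Fin k) ℂ),
        (∀ l, IsCompletelyPositive (matCones p) (matCones k) (ψ l)) ∧
          ∀ X, φ X = ∑ l, M l * ψ l X * (M l).conjTranspose,
      ∃ (q : ℕ) (A : Fin q → Matrix (Fin p) (Fin m) ℂ),
        (∀ l, (A l).rank ≤ k) ∧ ∀ X, φ X = ∑ l, (A l).conjTranspose * X * A l,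
      IsCompletelyPositive (OMIN k p) (OMAX k m) φ] := by
  obtain ⟨hkp, hkm⟩ := le_min_iff.1 hkpm
  -- Conditions (ii), (iv) and (v) all become membership of the Choi matrix in the Schmidt cone.
  rw [isKPartiallyEntanglementBreaking_iff (hk.trans hkm),
    exists_completelyPositive_factorization_iff hkm, exists_kraus_iff]
  tfae_have 2 → 6 := isCompletelyPositive_OMIN_OMAX_of_kraus hk hkp hkm
  tfae_have 6 → 1 := fun h n X hX =>
    mem_matCones_iff.2 (posSemidef_of_mem_schmidtCone ((mem_OMAX_iff hk hkm).1 (h n X hX)))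
  tfae_have 6 → 3 := fun h n X hX => h n X (matCones_subset_OMIN hkp hX)
  tfae_have 1 → 2 := choiMatrix_mem_of_isCompletelyPositive_OMIN hkp
  tfae_have 3 → 2 := choiMatrix_mem_of_isCompletelyPositive_OMAX hk hkm
  tfae_have 2 ↔ 4 := Iff.rfl
  tfae_have 2 ↔ 5 := Iff.rfl
  tfae_finish
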